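/- Let $d\ge 1$, let $B_R\subset\mathbb R^d$ be the open Euclidean ball of radius $R$ centred at $0$, and let $X\subset\mathbb R^d$ be uniformly discrete: there is $r>0$ with $|x-y|\ge r$ for all distinct $x,y\in X$. Assume: (H.1) there is a constant $\mathrm{dens}(X)>0$ with $\#(X\cap B_R)-\mathrm{dens}(X)\,\mathrm{Vol}(B_R)=o(R^d)$ as $R\to\infty$; (H.2) the diffraction measure of $X$ exists and is singular with respect to Lebesgue measure, i.e. there is a positive Radon measure $\widehat{\gamma_X}$ on $\mathbb R^d$, singular with respect to Lebesgue measure, such that for all $f\in C_c^\infty(\mathbb R^d)$ $$\int f\,d\widehat{\gamma_X}=\lim_{R\to\infty}\frac1{\mathrm{Vol}(B_R)}\int_{\mathbb R^d} f(\lambda)\Bigl|\sum_{p\in X\cap B_R}e^{-2\pi i\langle p,\lambda\rangle}\Bigr|^2d\lambda .$$ Let $(\xi_p)_{p\in X}$ be i.i.d. random vectors in $\mathbb R^d$, with the law of a random vector $\xi$ such that $\mathbb E|\xi|^{d+\varepsilon}<\infty$ for some $\varepsilon>0$. Let $X_\xi$ be the perturbed configuration $\{p+\xi_p:p\in X\}$,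 its points counted with multiplicity, and put $$M_R(\lambda)=\frac1{\mathrm{Vol}(B_R)}\sum_{p\in X:\ p+\xi_p\in B_R}e^{-2\pi i\langle p+\xi_p,\lambda\rangle},\qquad S_R(\lambda)=\frac1{\mathrm{Vol}(B_R)}\sum_{p\in X\cap B_R}e^{-2\pi i\langle p,\lambda\rangle}.$$ Then almost surely $X_\xi$ has finitely many points in every $B_R$, and for every $\lambda\in\mathbb R^d$ $$\lim_{R\to\infty}\Bigl(M_R(\lambda)-\mathbb E\bigl[e^{-2\pi i\langle\xi,\lambda\rangle}\bigr]\,S_R(\lambda)\Bigr)=0 .$$ Consequently, almost surely, for every $\lambda$ at which the weak Fourier transform $\widehat{\delta_X}(\lambda):=\lim_{R\to\infty}S_R(\lambda)$ exists, $$\lim_{R\to\infty}M_R(\lambda)=\mathbb E\bigl[e^{-2\pi i\langle\xi,\lambda\rangle}\bigr]\,\widehat{\delta_X}(\lambda).$$ Moreover, almost surely, the (complex) measures $\bigl(M_R(\lambda)-\mathbb E[e^{-2\pi i\langle\xi,\lambda\rangle}]\,S_R(\lambda)\bigr)\,d\lambda$ converge vaguely to $0$ as $R\to\infty$. -/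

import Mathlib

open MeasureTheory ProbabilityTheory Filter Topology Asymptotics

noncomputable section

namespace PerturbedSet

open scoped ContDiff

/-- Euclidean space `ℝ^d`. -/
abbrev E (d : ℕ) : Type := EuclideanSpace ℝ (Fin d)

variable {d : ℕ}

/-- The Lebesgue volume of the open ball `B_R` of radius `R` centred at the origin of `ℝ^d`. -/
def volBall (d : ℕ) (R : ℝ) : ℝ := (volume : Measure (E d)).real (Metric.ball 0 R)

/-- The character `e^{-2πi⟨x,k⟩}`. -/
def character (k x : E d) : ℂ :=
  Complex.exp (-2 * (Real.pi : ℂ) * Complex.I * ((inner ℝ x k : ℝ) : ℂ))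

/-- Distinct points of `X` are at distance at least some fixed `r > 0`. -/
def UniformlyDiscrete (X : Set (E d)) : Prop :=
  ∃ r : ℝ, 0 < r ∧ ∀ x ∈ X, ∀ y ∈ X, x ≠ y → r ≤ dist x y

/-- `X` has a (positive) asymptotic density:
`#(X ∩ B_R) - dens · Vol(B_R) = o(R^d)` as `R → ∞`. -/
def HasAsymptoticDensity (X : Set (E d)) : Prop :=
  ∃ dens : ℝ, 0 < dens ∧
    (fun R : ℝ => ((X ∩ Metric.ball 0 R).ncard : ℝ) - dens * volBall d R)
      =o[atTop] (fun R : ℝ => R ^ d)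

/-- The exponential sum `∑_{p ∈ X ∩ B_R} e^{-2πi⟨p,k⟩}`
(a finite sum for uniformly discrete `X`). -/
def expSum (X : Set (E d)) (R : ℝ) (k : E d) : ℂ :=
  ∑ᶠ p ∈ X ∩ Metric.ball 0 R, character k p

/-- `γ` is the diffraction measure of `∑_{p ∈ X} δ_p`: a positive Radon measure that is the limit of
the measures `Vol(B_R)⁻¹ |∑_{p ∈ X ∩ B_R} e^{-2πi⟨p,k⟩}|² dk`, tested on `C_c^∞`. -/
def IsDiffractionMeasure (X : Set (E d)) (γ : Measure (E d)) : Prop :=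
  IsLocallyFiniteMeasure γ ∧
    ∀ f : E d → ℝ, ContDiff ℝ ∞ f → HasCompactSupport f →
      Tendsto (fun R : ℝ => (volBall d R)⁻¹ * ∫ k, f k * ‖expSum X R k‖ ^ 2)
        atTop (𝓝 (∫ k, f k ∂γ))

/-- The diffraction measure of `X` exists and is singular with respect to Lebesgue measure. -/
def HasSingularDiffraction (X : Set (E d)) : Prop :=
  ∃ γ : Measure (E d), IsDiffractionMeasure X γ ∧ γ ⟂ₘ (volume : Measure (E d))

/-- The normalized exponential sum `Vol(B_R)⁻¹ ∑_{p ∈ X ∩ B_R} e^{-2πi⟨p,k⟩}` of `X`. -/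
def meanExp (X : Set (E d)) (R : ℝ) (k : E d) : ℂ :=
  ((volBall d R : ℝ) : ℂ)⁻¹ * expSum X R k

/-- The weak Fourier transform of `∑_{p ∈ X} δ_p` exists at `k`, with value `a`. -/
def HasWeakFourier (X : Set (E d)) (k : E d) (a : ℂ) : Prop :=
  Tendsto (fun R : ℝ => meanExp X R k) atTop (𝓝 a)

/-- The normalized exponential sum `M_R(k)` of the perturbed configuration `{p + v p : p ∈ X}`,
the points being counted with multiplicity (that is, the sum of `e^{-2πi⟨x,k⟩}` over `B_R`
against `∑_{p ∈ X} δ_{p + v p}`). -/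
def perturbedMeanExp (X : Set (E d)) (v : X → E d) (R : ℝ) (k : E d) : ℂ :=
  ((volBall d R : ℝ) : ℂ)⁻¹ *
    ∑ᶠ (p : X) (_ : (p : E d) + v p ∈ Metric.ball (0 : E d) R), character k ((p : E d) + v p)

end PerturbedSet

end

open PerturbedSet

namespace PerturbedSet

variable {d : ℕ}

/-! Write φ for the characteristic function of the law. Up to the points that enter or leave `B_R`,
the difference in the theorem is the normalized sum over `X ∩ B_R` of the fluctuations `fluct`,
which are independent, centred and bounded by 2.

Crossing points: Borel–Cantelli and the moment of order `d` show that, almost surely, only finitely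
many points are moved by more than η times their norm (`ae_finite_farMoved`). The other crossing
points lie in a thin shell around the sphere, and the asymptotic density makes their number an
arbitrarily small fraction of `R^d` (`tendsto_crossing`).

Fluctuations: for one frequency, Hoeffding's inequality bounds the probability of a sum of size `η
n^d` by a constant times `exp(-c n^d)`. This beats any polynomial number of frequencies, so the
estimate holds on a whole grid that gets finer and larger with `n` (`ae_eventually_grid`). The
fluctuations are Lipschitz in the frequency, with constant `O(n)` on `B_n`, and this carries the
estimate from the grid to every frequency on one almost sure event (`tendsto_sum_fluct_of_grid`). -/

/-! ### Counting points of `X` in balls -/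

lemma UniformlyDiscrete.finite_inter_ball {X : Set (E d)} (hX : UniformlyDiscrete X) (R : ℝ) :
    (X ∩ Metric.ball 0 R).Finite := by
  obtain ⟨r, hr, h⟩ := hX
  rw [Set.inter_comm]
  have hd : DiscreteTopology X :=
    DiscreteTopology.of_forall_le_dist hr fun x y hxy =>
      h x x.2 y y.2 (fun he => hxy (Subtype.ext he))
  exact Metric.finite_isBounded_inter_isClosed ⟨hd⟩ Metric.isBounded_ball
    (Metric.isClosed_of_pairwise_le_dist hr fun x hx y hy hxy => h x hx y hy hxy)

/-- The points of `X` in the ball `B_R`, as a set of elements of the subtype `X`. -/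
def ballPoints (X : Set (E d)) (R : ℝ) : Set X := {p | (p : E d) ∈ Metric.ball (0 : E d) R}

/-- The points of `X` whose perturbation by `v` lies in the ball `B_R`. -/
def perturbedPoints (X : Set (E d)) (v : X → E d) (R : ℝ) : Set X :=
  {p | (p : E d) + v p ∈ Metric.ball (0 : E d) R}

lemma mem_ballPoints {X : Set (E d)} {R : ℝ} {p : X} :
    p ∈ ballPoints X R ↔ ‖(p : E d)‖ < R := by
  simp [ballPoints]

lemma mem_perturbedPoints {X : Set (E d)} {v : X → E d} {R : ℝ} {p : X} :
    p ∈ perturbedPoints X v R ↔ ‖(p : E d) + v p‖ < R := by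
  simp [perturbedPoints]

lemma image_ballPoints (X : Set (E d)) (R : ℝ) :
    Subtype.val '' ballPoints X R = X ∩ Metric.ball 0 R := by
  ext x
  simp only [ballPoints, Set.mem_image, Set.mem_ofPred_eq, Set.mem_inter_iff]
  constructor
  · rintro ⟨p, hp, rfl⟩
    exact ⟨p.2, hp⟩
  · rintro ⟨hx, hR⟩
    exact ⟨⟨x, hx⟩, hR, rfl⟩

lemma ncard_ballPoints (X : Set (E d)) (R : ℝ) :
    (ballPoints X R).ncard = (X ∩ Metric.ball 0 R).ncard := by
  rw [← image_ballPoints, Set.ncard_image_of_injective _ Subtype.val_injective]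

lemma UniformlyDiscrete.finite_ballPoints {X : Set (E d)} (hX : UniformlyDiscrete X) (R : ℝ) :
    (ballPoints X R).Finite := by
  refine Set.Finite.of_finite_image ?_ Subtype.val_injective.injOn
  rw [image_ballPoints]
  exact hX.finite_inter_ball R

lemma ballPoints_mono (X : Set (E d)) {R S : ℝ} (h : R ≤ S) : ballPoints X R ⊆ ballPoints X S :=
  fun _ hp => mem_ballPoints.2 ((mem_ballPoints.1 hp).trans_le h)

lemma UniformlyDiscrete.countable {X : Set (E d)} (hX : UniformlyDiscrete X) : Countable X := by
  have h : (Set.univ : Set X) = ⋃ n : ℕ, ballPoints X n := by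
    symm
    rw [Set.eq_univ_iff_forall]
    intro p
    obtain ⟨n, hn⟩ := exists_nat_gt ‖(p : E d)‖
    exact Set.mem_iUnion.2 ⟨n, mem_ballPoints.2 hn⟩
  rw [← Set.countable_univ_iff, h]
  exact Set.countable_iUnion fun n => (hX.finite_ballPoints n).countable

lemma expSum_eq_finsum (X : Set (E d)) (R : ℝ) (k : E d) :
    expSum X R k = ∑ᶠ p ∈ ballPoints X R, character k (p : E d) := by
  rw [expSum, ← image_ballPoints, finsum_mem_image Subtype.val_injective.injOn]

/-- The volume of the unit ball. -/
noncomputable def unitVol (d : ℕ) : ℝ := volBall d 1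

lemma unitVol_pos (d : ℕ) : 0 < unitVol d := by
  unfold unitVol volBall
  exact ENNReal.toReal_pos (Metric.measure_ball_pos _ _ one_pos).ne' measure_ball_lt_top.ne

lemma volBall_eq (d : ℕ) {R : ℝ} (hR : 0 < R) : volBall d R = unitVol d * R ^ d := by
  unfold unitVol volBall
  rw [measureReal_def, Measure.addHaar_ball_of_pos _ _ hR, ENNReal.toReal_mul,
    ENNReal.toReal_ofReal (by positivity), measureReal_def, mul_comm]
  simp

/-- The number of points of `X` in `B_R`. -/
noncomputable def count (X : Set (E d)) (R : ℝ) : ℝ := (ballPoints X R).ncard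

lemma HasAsymptoticDensity.exists_tendsto {X : Set (E d)} (h : HasAsymptoticDensity X) :
    ∃ κ : ℝ, Tendsto (fun R : ℝ => count X R / R ^ d) atTop (𝓝 κ) := by
  obtain ⟨D, -, hD⟩ := h
  refine ⟨D * unitVol d, ?_⟩
  have h1 := (hD.tendsto_div_nhds_zero).add_const (D * unitVol d)
  rw [zero_add] at h1
  refine h1.congr' ?_
  filter_upwards [eventually_gt_atTop 0] with R hR
  rw [volBall_eq d hR, count, ncard_ballPoints]
  field_simp
  ring

lemma count_mono {X : Set (E d)} (hX : UniformlyDiscrete X) {R S : ℝ} (h : R ≤ S) :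
    count X R ≤ count X S :=
  Nat.cast_le.2 (Set.ncard_le_ncard (ballPoints_mono X h) (hX.finite_ballPoints S))

lemma exists_count_le {X : Set (E d)} (hX : UniformlyDiscrete X) (h : HasAsymptoticDensity X) :
    ∃ C : ℝ, 0 < C ∧ ∀ R : ℝ, 0 ≤ R → count X R ≤ C * (1 + R ^ d) := by
  obtain ⟨κ, hκ⟩ := h.exists_tendsto
  have h1 := (hκ.eventually (gt_mem_nhds (lt_add_one κ))).and (eventually_gt_atTop 0)
  obtain ⟨R₀, h0⟩ := eventually_atTop.1 h1
  set T := max R₀ 1 with hT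
  refine ⟨max (|κ| + 1) (count X T + 1), lt_max_of_lt_left (by positivity), fun R hR => ?_⟩
  rcases le_total R T with hRT | hRT
  · calc count X R ≤ count X T + 1 := (count_mono hX hRT).trans (by simp)
      _ ≤ max (|κ| + 1) (count X T + 1) * 1 := by simp
      _ ≤ _ := by gcongr; linarith [pow_nonneg hR d]
  · obtain ⟨h2, h3⟩ := h0 R ((le_max_left _ _).trans hRT)
    rw [div_lt_iff₀ (by positivity)] at h2
    calc count X R ≤ (κ + 1) * R ^ d := h2.le
      _ ≤ max (|κ| + 1) (count X T + 1) * (1 + R ^ d) := by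
        gcongr
        · exact le_max_of_le_left (by linarith [le_abs_self κ])
        · linarith

/-- Serves both dilated balls, `g R = R * a`, and the passage to integer radii, `g R = ⌈R⌉₊`. -/
lemma count_scale_tendsto {X : Set (E d)} {κ : ℝ}
    (hκ : Tendsto (fun R : ℝ => count X R / R ^ d) atTop (𝓝 κ)) {g : ℝ → ℝ} {a : ℝ} (ha : 0 < a)
    (hg : Tendsto (fun R => g R / R) atTop (𝓝 a)) :
    Tendsto (fun R : ℝ => count X (g R) / R ^ d) atTop (𝓝 (κ * a ^ d)) := by
  have hgt : Tendsto g atTop atTop := by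
    refine (hg.pos_mul_atTop ha tendsto_id).congr' ?_
    filter_upwards [eventually_gt_atTop 0] with R hR
    simp only [id]
    field_simp
  refine ((hκ.comp hgt).mul (hg.pow d)).congr' ?_
  filter_upwards [eventually_gt_atTop 0, hgt.eventually_gt_atTop 0] with R hR hgR
  simp only [Function.comp, div_pow]
  field_simp

/-! ### Characters -/

lemma norm_character (k x : E d) : ‖character k x‖ = 1 := by
  have : -2 * (Real.pi : ℂ) * Complex.I * ((inner ℝ x k : ℝ) : ℂ)
      = ((-2 * Real.pi * inner ℝ x k : ℝ) : ℂ) * Complex.I := by push_cast; ring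
  rw [character, this, Complex.norm_exp_ofReal_mul_I]

lemma character_add (k x y : E d) : character k (x + y) = character k x * character k y := by
  rw [character, character, character, ← Complex.exp_add, inner_add_left]
  push_cast
  ring_nf

lemma continuous_character_left (x : E d) : Continuous fun k : E d => character k x := by
  unfold character
  fun_prop

lemma continuous_character_right (k : E d) : Continuous fun x : E d => character k x := by
  unfold character
  fun_prop

lemma norm_character_sub_le (k l x : E d) :
    ‖character k x - character l x‖ ≤ 2 * Real.pi * (‖x‖ * ‖k - l‖) := by
  have h : character k x = character l x * character (k - l) x := by
    rw [character, character, character, ← Complex.exp_add, inner_sub_right]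
    push_cast
    ring_nf
  have h2 : character (k - l) x
      = Complex.exp (Complex.I * ((-(2 * Real.pi * inner ℝ x (k - l)) : ℝ) : ℂ)) := by
    rw [character]
    push_cast
    ring_nf
  rw [h, ← mul_sub_one, norm_mul, norm_character, one_mul, h2]
  refine Real.norm_exp_I_mul_ofReal_sub_one_le.trans ?_
  rw [norm_neg, norm_mul, Real.norm_of_nonneg (by positivity)]
  gcongr
  exact norm_inner_le_norm x (k - l)

lemma norm_sum_sub_sum_le {ι : Type*} [DecidableEq ι] (s t : Finset ι) {f : ι → ℂ} {C : ℝ}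
    (hf : ∀ i, ‖f i‖ ≤ C) :
    ‖∑ i ∈ t, f i - ∑ i ∈ s, f i‖ ≤ C * ((t \ s).card + (s \ t).card : ℕ) := by
  rw [← Finset.sum_sdiff_sub_sum_sdiff]
  refine (norm_sub_le _ _).trans ?_
  have h1 := norm_sum_le_of_le (t \ s) fun i _ => hf i
  have h2 := norm_sum_le_of_le (s \ t) fun i _ => hf i
  simp only [Finset.sum_const, nsmul_eq_mul] at h1 h2
  push_cast
  linarith

/-! ### Points crossing the boundary of the ball -/

/-- The points of `X` that `v` moves by more than `η` times their norm. -/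
def farMoved (X : Set (E d)) (v : X → E d) (η : ℝ) : Set X := {p | η * ‖(p : E d)‖ < ‖v p‖}

lemma notMem_farMoved {X : Set (E d)} {v : X → E d} {η : ℝ} {p : X} (h : p ∉ farMoved X v η) :
    ‖v p‖ ≤ η * ‖(p : E d)‖ :=
  not_lt.1 h

lemma finite_perturbedPoints {X : Set (E d)} (hX : UniformlyDiscrete X) {v : X → E d}
    (hv : ∀ η : ℝ, 0 < η → (farMoved X v η).Finite) (R : ℝ) : (perturbedPoints X v R).Finite := by
  refine ((hv (1 / 2) (by norm_num)).union (hX.finite_ballPoints (2 * R))).subset fun p hp => ?_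
  by_cases h : p ∈ farMoved X v (1 / 2)
  · exact Or.inl h
  · refine Or.inr (mem_ballPoints.2 ?_)
    have h1 := notMem_farMoved h
    have h2 := mem_perturbedPoints.1 hp
    have h3 := norm_sub_le ((p : E d) + v p) (v p)
    rw [add_sub_cancel_right] at h3
    linarith

/-- The number of points of `X` that enter or leave `B_R` under the perturbation `v`. -/
noncomputable def crossing (X : Set (E d)) (v : X → E d) (R : ℝ) : ℝ :=
  (symmDiff (perturbedPoints X v R) (ballPoints X R)).ncard

/-- A point outside `farMoved` has its norm changed by a factor between `1 - η` and `1 + η`. The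
outer radius comes from `1 / (1 - η) ≤ 1 + 2 * η`, valid for `η ≤ 1 / 2`; the inner one from `1 - η
≤ 1 / (1 + η)`. -/
lemma symmDiff_subset (X : Set (E d)) (v : X → E d) {η : ℝ} (h0 : 0 < η) (h1 : η ≤ 1 / 2)
    {R : ℝ} (hR : 0 < R) :
    symmDiff (perturbedPoints X v R) (ballPoints X R) ⊆
      farMoved X v η ∪ (ballPoints X (R * (1 + 2 * η)) \ ballPoints X (R * (1 - η))) := by
  intro p hp
  by_cases h : p ∈ farMoved X v η
  · exact Or.inl h
  right
  have hle := notMem_farMoved h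
  have h3 := norm_sub_le ((p : E d) + v p) (v p)
  rw [add_sub_cancel_right] at h3
  have h4 := norm_add_le (p : E d) (v p)
  have hn := norm_nonneg (p : E d)
  rw [Set.mem_sdiff, mem_ballPoints, mem_ballPoints, not_lt]
  rw [Set.mem_symmDiff, mem_perturbedPoints, mem_ballPoints, not_lt, not_lt] at hp
  rcases hp with ⟨ha, hb⟩ | ⟨ha, hb⟩
  · have hlt : ‖(p : E d)‖ * (1 - η) < R := by linarith
    refine ⟨?_, by nlinarith⟩
    have h5 : R ≤ R * (1 + 2 * η) * (1 - η) := by nlinarith [mul_pos hR h0]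
    exact lt_of_mul_lt_mul_right (hlt.trans_le h5) (by linarith)
  · refine ⟨by nlinarith [mul_pos hR h0], ?_⟩
    have h5 : R ≤ ‖(p : E d)‖ * (1 + η) := by linarith
    refine le_of_mul_le_mul_right (le_trans ?_ h5) (by linarith : 0 < 1 + η)
    nlinarith [mul_pos hR (mul_pos h0 h0)]

lemma ncard_diff_ballPoints {X : Set (E d)} (hX : UniformlyDiscrete X) {R S : ℝ} (h : R ≤ S) :
    ((ballPoints X S \ ballPoints X R).ncard : ℝ) = count X S - count X R := by
  rw [count, count, eq_sub_iff_add_eq, ← Nat.cast_add,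
    Set.ncard_sdiff_add_ncard_of_subset (ballPoints_mono X h) (hX.finite_ballPoints S)]

lemma crossing_le {X : Set (E d)} (hX : UniformlyDiscrete X) {v : X → E d} {η : ℝ} (h0 : 0 < η)
    (h1 : η ≤ 1 / 2) (hv : (farMoved X v η).Finite) {R : ℝ} (hR : 0 < R) :
    crossing X v R ≤
      (farMoved X v η).ncard + (count X (R * (1 + 2 * η)) - count X (R * (1 - η))) := by
  rw [← ncard_diff_ballPoints hX (by nlinarith), crossing, ← Nat.cast_add, Nat.cast_le]
  exact (Set.ncard_le_ncard (symmDiff_subset X v h0 h1 hR)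
    (hv.union ((hX.finite_ballPoints _).subset Set.sdiff_subset))).trans (Set.ncard_union_le _ _)

/-- For fixed `η` the finite set `farMoved` is negligible against `R ^ d`, and the shell contributes
`κ * ((1 + 2 * η) ^ d - (1 - η) ^ d)` in the limit; this tends to 0 with `η`. -/
lemma tendsto_crossing (hd : 0 < d) {X : Set (E d)} (hX : UniformlyDiscrete X)
    (hdens : HasAsymptoticDensity X) {v : X → E d}
    (hv : ∀ η : ℝ, 0 < η → (farMoved X v η).Finite) :
    Tendsto (fun R : ℝ => crossing X v R / R ^ d) atTop (𝓝 0) := by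
  obtain ⟨κ, hκ⟩ := hdens.exists_tendsto
  have hlim : Tendsto (fun η : ℝ => 0 + (κ * (1
      + 2 * η) ^ d - κ * (1 - η) ^ d)) (𝓝[>] 0) (𝓝 0) := by
    have : Continuous fun η : ℝ => 0 + (κ * (1 + 2 * η) ^ d - κ * (1 - η) ^ d) := by fun_prop
    have h := this.tendsto 0
    simp only [mul_zero, add_zero, sub_zero, sub_self] at h
    exact h.mono_left nhdsWithin_le_nhds
  refine tendsto_order.2 ⟨fun b hb => ?_, fun b hb => ?_⟩
  · filter_upwards [eventually_gt_atTop 0] with R hR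
    exact hb.trans_le (div_nonneg (Nat.cast_nonneg _) (by positivity))
  · have hsmall : ∀ᶠ η : ℝ in 𝓝[>] 0, η ≤ 1 / 2 :=
      nhdsWithin_le_nhds (Iic_mem_nhds (by norm_num))
    obtain ⟨η, ⟨hη, hη1⟩, hη0⟩ :=
      ((hlim.eventually (gt_mem_nhds hb)).and hsmall |>.and self_mem_nhdsWithin).exists
    have hη0 : 0 < η := hη0
    have hscale : ∀ a : ℝ, Tendsto (fun R : ℝ => R * a / R) atTop (𝓝 a) := fun a =>
      tendsto_const_nhds.congr' (by
        filter_upwards [eventually_gt_atTop 0] with R hR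
        field_simp)
    have hT : Tendsto (fun R : ℝ => ((farMoved X v η).ncard : ℝ) / R ^ d
        + (count X (R * (1 + 2 * η)) / R ^ d - count X (R * (1 - η)) / R ^ d)) atTop
        (𝓝 (0 + (κ * (1 + 2 * η) ^ d - κ * (1 - η) ^ d))) :=
      (tendsto_const_nhds.div_atTop (tendsto_pow_atTop hd.ne')).add
        ((count_scale_tendsto hκ (by linarith) (hscale _)).sub
          (count_scale_tendsto hκ (by linarith) (hscale _)))
    filter_upwards [hT.eventually (gt_mem_nhds hη), eventually_gt_atTop 0] with R hR hR0
    refine lt_of_le_of_lt ?_ hR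
    rw [← sub_div, ← add_div]
    gcongr
    exact crossing_le hX hη0 hη1 (hv η hη0) hR0

lemma card_sdiff_add_card_sdiff {ι : Type*} [DecidableEq ι] {s t : Set ι} (hs : s.Finite)
    (ht : t.Finite) :
    (hs.toFinset \ ht.toFinset).card + (ht.toFinset \ hs.toFinset).card = (symmDiff s t).ncard := by
  rw [← Finset.card_union_of_disjoint disjoint_sdiff_sdiff, ← Set.ncard_coe_finset]
  congr 1
  ext x
  simp [Set.mem_symmDiff]

/-- The fluctuation `e^{-2πi⟨p+v_p,k⟩} - c e^{-2πi⟨p,k⟩}`. -/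
noncomputable def fluct (c : ℂ) (k p w : E d) : ℂ := character k (p + w) - c * character k p

lemma norm_fluct_le {c : ℂ} (hc : ‖c‖ ≤ 1) (k p w : E d) : ‖fluct c k p w‖ ≤ 2 := by
  refine (norm_sub_le _ _).trans ?_
  rw [norm_mul, norm_character, norm_character]
  linarith

/-! ### Deterministic reduction to fluctuation sums -/

section Sums

variable {X : Set (E d)} {v : X → E d}

lemma meanExp_eq_sum (hX : UniformlyDiscrete X) (R : ℝ) (k : E d) :
    meanExp X R k = ((volBall d R : ℝ) : ℂ)⁻¹ *
      ∑ p ∈ (hX.finite_ballPoints R).toFinset, character k (p : E d) := by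
  rw [meanExp, expSum_eq_finsum, finsum_mem_eq_finite_toFinset_sum]

lemma perturbedMeanExp_eq_sum (hX : UniformlyDiscrete X) (hv : ∀ η : ℝ, 0 < η →
    (farMoved X v η).Finite) (R : ℝ) (k : E d) :
    perturbedMeanExp X v R k = ((volBall d R : ℝ) : ℂ)⁻¹ *
      ∑ p ∈ (finite_perturbedPoints hX hv R).toFinset, character k ((p : E d) + v p) := by
  rw [perturbedMeanExp, ← finsum_mem_eq_finite_toFinset_sum]
  rfl

/-- Replacing the perturbed index set by `B_R` costs at most one unit per crossing point; what
remains is exactly the fluctuation sum. -/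
lemma norm_sub_meanExp_le (hX : UniformlyDiscrete X) (hv : ∀ η : ℝ, 0 < η →
    (farMoved X v η).Finite) {R : ℝ} (hR : 0 < R)
    (c : ℂ) (k : E d) :
    ‖perturbedMeanExp X v R k - c * meanExp X R k‖ ≤ (unitVol d)⁻¹ *
      (crossing X v R / R ^ d
        + ‖∑ p ∈ (hX.finite_ballPoints R).toFinset, fluct c k p (v p)‖ / R ^ d) := by
  classical
  have h1 := norm_sum_sub_sum_le (hX.finite_ballPoints R).toFinset
    (finite_perturbedPoints hX hv R).toFinset (f := fun p : X => character k ((p : E d) + v p))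
    (C := 1) (fun p => (norm_character _ _).le)
  rw [one_mul, card_sdiff_add_card_sdiff] at h1
  have h2 : perturbedMeanExp X v R k - c * meanExp X R k = ((volBall d R : ℝ) : ℂ)⁻¹ *
      ((∑ p ∈ (finite_perturbedPoints hX hv R).toFinset, character k ((p : E d) + v p)
        - ∑ p ∈ (hX.finite_ballPoints R).toFinset, character k ((p : E d) + v p))
      + ∑ p ∈ (hX.finite_ballPoints R).toFinset, fluct c k p (v p)) := by
    rw [meanExp_eq_sum hX, perturbedMeanExp_eq_sum hX hv]
    simp only [fluct, Finset.sum_sub_distrib, ← Finset.mul_sum]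
    ring
  rw [h2, norm_mul, norm_inv, Complex.norm_real, volBall_eq d hR,
    Real.norm_of_nonneg (mul_pos (unitVol_pos d) (by positivity)).le, mul_inv, mul_assoc,
    ← add_div, div_eq_inv_mul]
  have := (unitVol_pos d).le
  gcongr
  exact (norm_add_le _ _).trans (add_le_add_left h1 _)

lemma norm_sum_fluct_le (hX : UniformlyDiscrete X) {c : ℂ} (hc : ‖c‖ ≤ 1) (R : ℝ) (k : E d) :
    ‖∑ p ∈ (hX.finite_ballPoints R).toFinset, fluct c k p (v p)‖ ≤ 2 * count X R := by
  refine (norm_sum_le_of_le _ fun (p : X) _ => norm_fluct_le hc k p (v p)).trans ?_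
  rw [Finset.sum_const, nsmul_eq_mul, mul_comm, count,
    Set.ncard_eq_toFinset_card _ (hX.finite_ballPoints R)]

/-- The bound is uniform in the frequency, as needed to dominate the integrands in the vague limit.
-/
lemma exists_bound (hX : UniformlyDiscrete X) (hd : 0 < d) (hdens : HasAsymptoticDensity X)
    (hv : ∀ η : ℝ, 0 < η → (farMoved X v η).Finite) {φ : E d → ℂ} (hφ : ∀ k, ‖φ k‖ ≤ 1) :
    ∃ C : ℝ, ∀ᶠ R : ℝ in atTop, ∀ k,
      ‖perturbedMeanExp X v R k - φ k * meanExp X R k‖ ≤ C := by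
  obtain ⟨κ, hκ⟩ := hdens.exists_tendsto
  refine ⟨(unitVol d)⁻¹ * (1 + 2 * (κ + 1)), ?_⟩
  filter_upwards [eventually_gt_atTop 0, hκ.eventually (gt_mem_nhds (lt_add_one κ)),
    (tendsto_crossing hd hX hdens hv).eventually (gt_mem_nhds one_pos)] with R hR h1 h2 k
  refine (norm_sub_meanExp_le hX hv hR (φ k) k).trans ?_
  have := unitVol_pos d
  gcongr
  calc _ ≤ 2 * count X R / R ^ d := by gcongr; exact norm_sum_fluct_le hX (hφ k) R k
    _ = 2 * (count X R / R ^ d) := by ring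
    _ ≤ _ := by linarith

/-- Integer radii suffice: between `R` and `⌈R⌉₊` there are only `o(R ^ d)` points, each
contributing at most 2. -/
lemma tendsto_sub_meanExp (hX : UniformlyDiscrete X) (hd : 0 < d) (hdens : HasAsymptoticDensity X)
    (hv : ∀ η : ℝ, 0 < η → (farMoved X v η).Finite) {c : ℂ} (hc : ‖c‖ ≤ 1) {k : E d}
    (hk : Tendsto (fun n : ℕ =>
      ‖∑ p ∈ (hX.finite_ballPoints n).toFinset, fluct c k p (v p)‖ / (n : ℝ) ^ d) atTop (𝓝 0)) :
    Tendsto (fun R : ℝ => perturbedMeanExp X v R k - c * meanExp X R k) atTop (𝓝 0) := by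
  classical
  obtain ⟨κ, hκ⟩ := hdens.exists_tendsto
  have hceil : Tendsto (fun R : ℝ => (⌈R⌉₊ : ℝ) / R) atTop (𝓝 1) := tendsto_nat_ceil_div_atTop
  have hgap : Tendsto (fun R : ℝ => 2 * (count X (⌈R⌉₊ : ℝ) / R ^ d - count X R / R ^ d)) atTop
      (𝓝 0) := by
    have h := ((count_scale_tendsto hκ one_pos hceil).sub hκ).const_mul 2
    simpa using h
  have hk' : Tendsto (fun R : ℝ =>
      ‖∑ p ∈ (hX.finite_ballPoints (⌈R⌉₊ : ℝ)).toFinset, fluct c k p (v p)‖ / (⌈R⌉₊ : ℝ) ^ d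
        * ((⌈R⌉₊ : ℝ) / R) ^ d) atTop (𝓝 0) := by
    simpa using (hk.comp (tendsto_nat_ceil_atTop (α := ℝ))).mul (hceil.pow d)
  have hsum := ((tendsto_crossing hd hX hdens hv).add (hk'.add hgap)).const_mul (unitVol d)⁻¹
  simp only [add_zero, mul_zero] at hsum
  refine squeeze_zero_norm' ?_ hsum
  filter_upwards [eventually_gt_atTop 0] with R hR
  refine (norm_sub_meanExp_le hX hv hR c k).trans ?_
  have hn : 0 < (⌈R⌉₊ : ℝ) := Nat.cast_pos.2 (Nat.ceil_pos.2 hR)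
  have := unitVol_pos d
  gcongr
  have h1 := norm_sum_sub_sum_le (hX.finite_ballPoints (⌈R⌉₊ : ℝ)).toFinset
    (hX.finite_ballPoints R).toFinset (fun p : X => norm_fluct_le hc k p (v p))
  rw [card_sdiff_add_card_sdiff, symmDiff_of_le (ballPoints_mono X (Nat.le_ceil R)),
    ncard_diff_ballPoints hX (Nat.le_ceil R)] at h1
  have h2 := norm_le_norm_sub_add
    (∑ p ∈ (hX.finite_ballPoints R).toFinset, fluct c k p (v p))
    (∑ p ∈ (hX.finite_ballPoints (⌈R⌉₊ : ℝ)).toFinset, fluct c k p (v p))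
  have h3 : ‖∑ p ∈ (hX.finite_ballPoints (⌈R⌉₊ : ℝ)).toFinset, fluct c k p (v p)‖
      / (⌈R⌉₊ : ℝ) ^ d * ((⌈R⌉₊ : ℝ) / R) ^ d
      + 2 * (count X (⌈R⌉₊ : ℝ) / R ^ d - count X R / R ^ d)
      = (‖∑ p ∈ (hX.finite_ballPoints (⌈R⌉₊ : ℝ)).toFinset, fluct c k p (v p)‖
        + 2 * (count X (⌈R⌉₊ : ℝ) - count X R)) / R ^ d := by
    rw [div_pow]
    field_simp
  rw [h3]
  gcongr
  linarith

lemma tendsto_integral_mul_sub_meanExp (hX : UniformlyDiscrete X) (hd : 0 < d)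
    (hdens : HasAsymptoticDensity X)
    (hv : ∀ η : ℝ, 0 < η → (farMoved X v η).Finite) {φ : E d → ℂ} (hφ : ∀ k, ‖φ k‖ ≤ 1)
    (hφc : Continuous φ)
    (hlim : ∀ k, Tendsto (fun R : ℝ => perturbedMeanExp X v R k - φ k * meanExp X R k)
      atTop (𝓝 0))
    {f : E d → ℂ} (hf : Continuous f) (hfs : HasCompactSupport f) :
    Tendsto (fun R : ℝ => ∫ k, f k * (perturbedMeanExp X v R k - φ k * meanExp X R k))
      atTop (𝓝 0) := by
  obtain ⟨C, hC⟩ := exists_bound hX hd hdens hv hφ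
  have h0 : ∫ k : E d, f k * (0 : ℂ) = 0 := by simp
  rw [← h0]
  refine tendsto_integral_filter_of_dominated_convergence (fun k => ‖f k‖ * C) ?_ ?_ ?_ ?_
  · refine Eventually.of_forall fun R => Continuous.aestronglyMeasurable ?_
    simp only [meanExp_eq_sum hX, perturbedMeanExp_eq_sum hX hv]
    have h1 : ∀ x : E d, Continuous fun k : E d => character k x := continuous_character_left
    fun_prop
  · filter_upwards [hC] with R hR
    refine Eventually.of_forall fun k => ?_
    rw [norm_mul]
    gcongr
    exact hR k
  · exact ((hf.norm.integrable_of_hasCompactSupport hfs.norm).mul_const C)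
  · exact Eventually.of_forall fun k => (hlim k).const_mul (f k)

end Sums

/-! ### The grid of frequencies -/

/-- The points of `n⁻² ℤ^d` with all coordinates in `[-n, n]`. -/
noncomputable def grid (d n : ℕ) : Finset (E d) := by
  classical
  exact (Fintype.piFinset fun _ : Fin d => Finset.Icc (-(n : ℤ) ^ 3) ((n : ℤ) ^ 3)).image
    fun z => WithLp.toLp 2 fun i => (z i : ℝ) / (n : ℝ) ^ 2

lemma card_grid_le (d : ℕ) {n : ℕ} (hn : 0 < n) :
    ((grid d n).card : ℝ) ≤ 3 ^ d * (n : ℝ) ^ (3 * d) := by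
  classical
  have h1 : (grid d n).card ≤ (3 * n ^ 3) ^ d := by
    unfold grid
    refine Finset.card_image_le.trans ?_
    rw [Fintype.card_piFinset]
    simp only [Int.card_Icc, Finset.prod_const, Finset.card_univ, Fintype.card_fin]
    gcongr
    have : 0 < n ^ 3 := by positivity
    zify at this
    zify
    rw [Int.toNat_of_nonneg (by linarith)]
    linarith
  calc ((grid d n).card : ℝ) ≤ (((3 * n ^ 3) ^ d : ℕ) : ℝ) := Nat.cast_le.2 h1
    _ = _ := by push_cast; rw [mul_pow, pow_mul]

lemma exists_mem_grid {n : ℕ} (hn : 0 < n) {k : E d} (hk : ‖k‖ ≤ n) :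
    ∃ l ∈ grid d n, ‖k - l‖ ≤ d / (n : ℝ) ^ 2 := by
  classical
  have hn' : (0 : ℝ) < n := Nat.cast_pos.2 hn
  refine ⟨WithLp.toLp 2 fun i => ((⌊k i * (n : ℝ) ^ 2⌋ : ℤ) : ℝ) / (n : ℝ) ^ 2, ?_, ?_⟩
  · unfold grid
    refine Finset.mem_image.2 ⟨fun i => ⌊k i * (n : ℝ) ^ 2⌋, ?_, rfl⟩
    rw [Fintype.mem_piFinset]
    intro i
    have hi : |k i| ≤ n := (PiLp.norm_apply_le k i).trans hk
    rw [abs_le] at hi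
    rw [Finset.mem_Icc]
    have h2 : (0 : ℝ) < (n : ℝ) ^ 2 := by positivity
    constructor
    · rw [Int.le_floor]
      push_cast
      nlinarith
    · have : ((⌊k i * (n : ℝ) ^ 2⌋ : ℤ) : ℝ) ≤ (((n : ℤ) ^ 3 : ℤ) : ℝ) := by
        refine (Int.floor_le _).trans ?_
        push_cast
        nlinarith
      exact_mod_cast this
  · rw [EuclideanSpace.norm_eq]
    refine Real.sqrt_le_iff.2 ⟨by positivity, ?_⟩
    have h1 : ∀ i : Fin d, ‖(k - WithLp.toLp 2 fun i =>
        ((⌊k i * (n : ℝ) ^ 2⌋ : ℤ) : ℝ) / (n : ℝ) ^ 2 : E d) i‖ ^ 2 ≤ (1 / (n : ℝ) ^ 2) ^ 2 := by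
      intro i
      have h3 : (k - WithLp.toLp 2 fun i =>
        ((⌊k i * (n : ℝ) ^ 2⌋ : ℤ) : ℝ) / (n : ℝ) ^ 2 : E d) i
          = Int.fract (k i * (n : ℝ) ^ 2) / (n : ℝ) ^ 2 := by
        rw [Int.fract, PiLp.sub_apply]
        field_simp
      rw [h3, norm_div, Real.norm_of_nonneg (Int.fract_nonneg _),
          Real.norm_of_nonneg (by positivity)]
      gcongr
      exact (Int.fract_lt_one _).le
    refine (Finset.sum_le_sum fun i _ => h1 i).trans ?_
    rw [Finset.sum_const, Finset.card_univ, Fintype.card_fin, nsmul_eq_mul, div_pow, div_pow,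
      mul_div_assoc', one_pow, mul_one]
    gcongr
    -- The exact factor is `√d`; the cruder `d` needs `d ≤ d ^ 2`.
    rcases Nat.eq_zero_or_pos d with h | h
    · simp [h]
    · have : (1 : ℝ) ≤ d := Nat.one_le_cast.2 h
      nlinarith

/-! ### The characteristic function of the law -/

section Law

variable (ν : Measure (E d)) [IsProbabilityMeasure ν]

lemma integrable_character (k : E d) : Integrable (fun x => character k x) ν :=
  Integrable.of_bound (continuous_character_right k).aestronglyMeasurable 1
    (Eventually.of_forall fun x => (norm_character k x).le)

lemma norm_integral_character_le (k : E d) : ‖∫ x, character k x ∂ν‖ ≤ 1 := by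
  refine (norm_integral_le_integral_norm _).trans ?_
  simp [norm_character]

lemma continuous_integral_character : Continuous fun k : E d => ∫ x, character k x ∂ν :=
  continuous_of_dominated (fun k => (continuous_character_right k).aestronglyMeasurable)
    (fun k => Eventually.of_forall fun x => (norm_character k x).le) (integrable_const 1)
    (Eventually.of_forall fun x => continuous_character_left x)

variable {ν}

lemma norm_integral_character_sub_le (hν : Integrable (fun x : E d => ‖x‖) ν) (k l : E d) :
    ‖∫ x, character k x ∂ν - ∫ x, character l x ∂ν‖
      ≤ 2 * Real.pi * ((∫ x, ‖x‖ ∂ν) * ‖k - l‖) := by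
  rw [← integral_sub (integrable_character ν k) (integrable_character ν l),
    ← integral_mul_const, ← integral_const_mul]
  exact norm_integral_le_of_norm_le ((hν.mul_const _).const_mul _)
    (Eventually.of_forall fun x => norm_character_sub_le k l x)

lemma integrable_norm_pow {r : ℝ} (hν : Integrable (fun x : E d => ‖x‖ ^ r) ν) {m : ℕ}
    (hm : (m : ℝ) ≤ r) : Integrable (fun x : E d => ‖x‖ ^ m) ν := by
  refine ((integrable_const 1).add hν).mono' (by fun_prop) (Eventually.of_forall fun x => ?_)
  have hx := norm_nonneg x
  rw [Real.norm_of_nonneg (by positivity)]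
  have h0 := Real.rpow_nonneg hx r
  simp only [Pi.add_apply]
  rcases le_total ‖x‖ 1 with h | h
  · linarith [pow_le_one₀ hx h (n := m)]
  · rw [← Real.rpow_natCast]
    linarith [Real.rpow_le_rpow_of_exponent_le h hm]

end Law

/-! ### From the grid to all frequencies -/

lemma norm_fluct_sub_fluct_le {c e : ℂ} (hc : ‖c‖ ≤ 1) (k l p w : E d) :
    ‖fluct c k p w - fluct e l p w‖
      ≤ 2 * Real.pi * ((2 * ‖p‖ + ‖w‖) * ‖k - l‖) + ‖c - e‖ := by
  have h : fluct c k p w - fluct e l p w = (character k (p + w) - character l (p + w))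
      - (c * (character k p - character l p) + (c - e) * character l p) := by
    unfold fluct
    ring
  rw [h]
  refine (norm_sub_le _ _).trans ?_
  have h1 := norm_character_sub_le k l (p + w)
  have h2 := norm_character_sub_le k l p
  have h3 : ‖c * (character k p - character l p) + (c - e) * character l p‖
      ≤ ‖character k p - character l p‖ + ‖c - e‖ := by
    refine (norm_add_le _ _).trans ?_
    rw [norm_mul, norm_mul, norm_character, mul_one]
    gcongr
    exact mul_le_of_le_one_left (norm_nonneg _) hc
  have h4 : 2 * Real.pi * (‖p + w‖ * ‖k - l‖) ≤ 2 * Real.pi * ((‖p‖ + ‖w‖) * ‖k - l‖) := by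
    gcongr
    exact norm_add_le p w
  linarith

/-- Moving the frequency to a nearest grid point changes each term by `O(n) * ‖k - l‖`. The mesh
`n⁻²` makes this `O(1 / n)`, so the total change is `o(n ^ d)`. A fixed `k` is within the range of
the grid once `n ≥ ‖k‖`. -/
lemma tendsto_sum_fluct_of_grid {X : Set (E d)} (hX : UniformlyDiscrete X)
    (hdens : HasAsymptoticDensity X) {v : X → E d} (hv : (farMoved X v 1).Finite)
    {φ : E d → ℂ} (hφ : ∀ k, ‖φ k‖ ≤ 1) {L : ℝ} (hL : ∀ k l, ‖φ k - φ l‖ ≤ L * ‖k - l‖)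
    (hgrid : ∀ η : ℝ, 0 < η → ∀ᶠ n : ℕ in atTop, ∀ l ∈ grid d n,
      ‖∑ p ∈ (hX.finite_ballPoints n).toFinset, fluct (φ l) l p (v p)‖ ≤ η * (n : ℝ) ^ d)
    (k : E d) :
    Tendsto (fun n : ℕ =>
      ‖∑ p ∈ (hX.finite_ballPoints n).toFinset, fluct (φ k) k p (v p)‖ / (n : ℝ) ^ d)
      atTop (𝓝 0) := by
  obtain ⟨κ, hκ⟩ := hdens.exists_tendsto
  -- Finitely many exceptional displacements are bounded by some `W`, so every displacement grows at
  -- most linearly in the norm of its point.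
  obtain ⟨W, hW⟩ : ∃ W : ℝ, ∀ p ∈ farMoved X v 1, ‖v p‖ ≤ W := by
    obtain ⟨W, hW⟩ := (hv.image fun p => ‖v p‖).bddAbove
    exact ⟨W, fun p hp => hW (Set.mem_image_of_mem _ hp)⟩
  have hvW : ∀ p : X, ‖v p‖ ≤ ‖(p : E d)‖ + |W| := fun p => by
    by_cases hp : p ∈ farMoved X v 1
    · linarith [hW p hp, le_abs_self W, norm_nonneg (p : E d)]
    · linarith [notMem_farMoved hp, abs_nonneg W]
  have herr : Tendsto (fun n : ℕ => (count X n / (n : ℝ) ^ d) *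
      (6 * Real.pi * d * (1 / (n : ℝ)) + (2 * Real.pi * |W| + |L|) * d * (1 / (n : ℝ)) ^ 2))
      atTop (𝓝 0) := by
    have h1 : Tendsto (fun n : ℕ => 1 / (n : ℝ)) atTop (𝓝 0) := tendsto_one_div_atTop_nhds_zero_nat
    have h2 := (hκ.comp tendsto_natCast_atTop_atTop).mul
      ((h1.const_mul (6 * Real.pi * d)).add ((h1.pow 2).const_mul ((2 * Real.pi * |W| + |L|) * d)))
    simpa using h2
  refine tendsto_order.2 ⟨fun b hb => Eventually.of_forall fun n => hb.trans_le (by positivity),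
    fun b hb => ?_⟩
  filter_upwards [hgrid (b / 2) (half_pos hb), herr.eventually (gt_mem_nhds (half_pos hb)),
    eventually_gt_atTop 0, eventually_ge_atTop ⌈‖k‖⌉₊] with n h1 h2 hn hkn
  have hn' : (0 : ℝ) < n := Nat.cast_pos.2 hn
  obtain ⟨l, hl, hkl⟩ := exists_mem_grid hn (Nat.ceil_le.1 hkn)
  rw [div_lt_iff₀ (by positivity)]
  have h3 : ‖∑ p ∈ (hX.finite_ballPoints n).toFinset, fluct (φ k) k p (v p)
      - ∑ p ∈ (hX.finite_ballPoints n).toFinset, fluct (φ l) l p (v p)‖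
      ≤ count X n * (6 * Real.pi * d * (1 / (n : ℝ))
        + (2 * Real.pi * |W| + |L|) * d * (1 / (n : ℝ)) ^ 2) := by
    rw [← Finset.sum_sub_distrib]
    refine (norm_sum_le_of_le (f := fun p : X => fluct (φ k) k p (v p) - fluct (φ l) l p (v p))
      _ (n := fun _ => (6 * Real.pi * d * (1 / (n : ℝ))
        + (2 * Real.pi * |W| + |L|) * d * (1 / (n : ℝ)) ^ 2)) fun p hp => ?_).trans ?_
    · have hp' : ‖(p : E d)‖ < n := by
        rw [Set.Finite.mem_toFinset, mem_ballPoints] at hp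
        exact hp
      calc _ ≤ 2 * Real.pi * ((2 * ‖(p : E d)‖ + ‖v p‖) * ‖k - l‖) + ‖φ k - φ l‖ :=
            norm_fluct_sub_fluct_le (hφ k) k l p (v p)
        _ ≤ 2 * Real.pi * ((2 * n + (n + |W|)) * ‖k - l‖) + |L| * ‖k - l‖ := by
            gcongr
            · exact (hvW p).trans (by linarith)
            · exact (hL k l).trans (by gcongr; exact le_abs_self L)
        _ = (2 * Real.pi * (3 * n + |W|) + |L|) * ‖k - l‖ := by ring
        _ ≤ (2 * Real.pi * (3 * n + |W|) + |L|) * (d / (n : ℝ) ^ 2) := by gcongr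
        _ = _ := by
            field_simp
            ring
    · rw [Finset.sum_const, nsmul_eq_mul, count,
        Set.ncard_eq_toFinset_card _ (hX.finite_ballPoints n)]
  have h4 := norm_le_norm_sub_add
    (∑ p ∈ (hX.finite_ballPoints n).toFinset, fluct (φ k) k p (v p))
    (∑ p ∈ (hX.finite_ballPoints n).toFinset, fluct (φ l) l p (v p))
  have h5 : count X n * (6 * Real.pi * d * (1 / (n : ℝ))
        + (2 * Real.pi * |W| + |L|) * d * (1 / (n : ℝ)) ^ 2) < b / 2 * (n : ℝ) ^ d := by
    rwa [div_mul_eq_mul_div, div_lt_iff₀ (by positivity)] at h2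
  linarith [h1 l hl]

/-! ### Almost sure estimates -/

variable {X : Set (E d)} {Ω : Type*} [MeasurableSpace Ω] {P : Measure Ω}
  {ξ : X → Ω → E d} {ν : Measure (E d)}

/-- Borel–Cantelli. By Tonelli, the sum over `p` of the probabilities that `η * ‖p‖ < ‖ξ p‖` is the
expectation of `count X (‖ξ‖ / η)`, which is at most `C * (1 + 𝔼‖ξ‖ ^ d / η ^ d)`. -/
lemma ae_finite_farMoved (hX : UniformlyDiscrete X) (hdens : HasAsymptoticDensity X)
    (hlaw : ∀ p, HasLaw (ξ p) ν P) [IsProbabilityMeasure ν]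
    (hν : Integrable (fun x : E d => ‖x‖ ^ d) ν) {η : ℝ} (hη : 0 < η) :
    ∀ᵐ ω ∂P, (farMoved X (fun p => ξ p ω) η).Finite := by
  have := hX.countable
  obtain ⟨C, hC, hcount⟩ := exists_count_le hX hdens
  refine ae_finite_setOfPred_mem (s := fun p : X => {ω | η * ‖(p : E d)‖ < ‖ξ p ω‖}) ?_
  have hmeas : ∀ p : X, MeasurableSet {x : E d | η * ‖(p : E d)‖ < ‖x‖} := fun p =>
    measurableSet_lt measurable_const measurable_norm
  have h1 : ∀ p : X, P {ω | η * ‖(p : E d)‖ < ‖ξ p ω‖}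
      = ∫⁻ x, {x : E d | η * ‖(p : E d)‖ < ‖x‖}.indicator 1 x ∂ν := fun p => by
    rw [lintegral_indicator_one (hmeas p)]
    exact (hlaw p).measure_eq (p := fun x => η * ‖(p : E d)‖ < ‖x‖) (hmeas p)
  simp only [h1]
  rw [← lintegral_tsum fun p => (measurable_one.indicator (hmeas p)).aemeasurable]
  have hint : Integrable (fun x : E d => C * (1 + (‖x‖ ^ d) * (η⁻¹) ^ d)) ν :=
    ((integrable_const 1).add (hν.mul_const _)).const_mul C
  refine ne_top_of_le_ne_top hint.lintegral_lt_top.ne (lintegral_mono fun x => ?_)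
  have hfin := hX.finite_ballPoints (‖x‖ * η⁻¹)
  have hmem : ∀ p : X, p ∈ ballPoints X (‖x‖ * η⁻¹) ↔ η * ‖(p : E d)‖ < ‖x‖ := fun p => by
    rw [mem_ballPoints, ← div_eq_mul_inv, lt_div_iff₀ hη, mul_comm]
  have hzero : ∀ p ∉ hfin.toFinset,
      {x : E d | η * ‖(p : E d)‖ < ‖x‖}.indicator (1 : E d → ENNReal) x = 0 := fun p hp => by
    rw [Set.Finite.mem_toFinset, hmem] at hp
    exact Set.indicator_of_notMem (s := {x : E d | η * ‖(p : E d)‖ < ‖x‖}) hp _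
  have hone : ∀ p ∈ hfin.toFinset,
      {x : E d | η * ‖(p : E d)‖ < ‖x‖}.indicator (1 : E d → ENNReal) x = 1 := fun p hp => by
    rw [Set.Finite.mem_toFinset, hmem] at hp
    exact Set.indicator_of_mem (s := {x : E d | η * ‖(p : E d)‖ < ‖x‖}) hp _
  rw [tsum_eq_sum hzero, Finset.sum_congr rfl hone]
  simp only [Finset.sum_const, nsmul_eq_mul, mul_one]
  rw [← ENNReal.ofReal_natCast, ← Set.ncard_eq_toFinset_card _ hfin]
  refine ENNReal.ofReal_le_ofReal ?_
  rw [← mul_pow]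
  exact hcount _ (by positivity)

lemma ae_forall_finite_farMoved (hX : UniformlyDiscrete X) (hdens : HasAsymptoticDensity X)
    (hlaw : ∀ p, HasLaw (ξ p) ν P) [IsProbabilityMeasure ν]
    (hν : Integrable (fun x : E d => ‖x‖ ^ d) ν) :
    ∀ᵐ ω ∂P, ∀ η : ℝ, 0 < η → (farMoved X (fun p => ξ p ω) η).Finite := by
  have h : ∀ᵐ ω ∂P, ∀ m : ℕ, (farMoved X (fun p => ξ p ω) (1 / ((m : ℝ) + 1))).Finite :=
    ae_all_iff.2 fun m => ae_finite_farMoved hX hdens hlaw hν Nat.one_div_pos_of_nat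
  filter_upwards [h] with ω hω η hη
  obtain ⟨m, hm⟩ := exists_nat_one_div_lt hη
  refine (hω m).subset fun p hp => ?_
  have hp : η * ‖(p : E d)‖ < ‖ξ p ω‖ := hp
  exact lt_of_le_of_lt (b := η * ‖(p : E d)‖) (by gcongr) hp

lemma fluct_eq_mul (c : ℂ) (k p w : E d) :
    fluct c k p w = character k p * (character k w - c) := by
  rw [fluct, character_add]
  ring

lemma continuous_fluct (c : ℂ) (k p : E d) : Continuous fun w => fluct c k p w := by
  simp only [fluct_eq_mul]
  exact continuous_const.mul ((continuous_character_right k).sub continuous_const)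

/-- Hoeffding's inequality for real projections of the fluctuations; `u` selects the direction.
Values in `[-2, 2]` give variance proxy 4 per term, hence the 8 in the exponent. -/
lemma measure_sum_re_fluct_ge_le [IsProbabilityMeasure P] (hindep : iIndepFun ξ P)
    (hlaw : ∀ p, HasLaw (ξ p) ν P)
    [IsProbabilityMeasure ν] (s : Finset X) {M : ℝ} (hs : (s.card : ℝ) ≤ M) (k : E d)
    {u : ℂ} (hu : ‖u‖ ≤ 1) {t : ℝ} (ht : 0 < t) :
    P.real {ω | t ≤ ∑ p ∈ s, (u * fluct (∫ x, character k x ∂ν) k p (ξ p ω)).re}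
      ≤ Real.exp (-t ^ 2 / (8 * M)) := by
  set c := ∫ x, character k x ∂ν with hc
  -- With no terms, the Hoeffding exponent has denominator 0 and gives only the trivial bound 1; the
  -- event is then empty since `t > 0`.
  rcases s.eq_empty_or_nonempty with rfl | hne
  · simp [ht.not_ge, Real.exp_nonneg]
  have hg : ∀ p : X, Continuous fun w => (u * fluct c k p w).re := fun p =>
    Complex.continuous_re.comp (continuous_const.mul (continuous_fluct c k p))
  have hI : iIndepFun (fun (p : X) ω => (u * fluct c k p (ξ p ω)).re) P :=
    hindep.comp (fun (p : X) w => (u * fluct c k p w).re) fun p => (hg p).measurable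
  have hsub : ∀ p ∈ s, HasSubgaussianMGF (fun ω => (u * fluct c k p (ξ p ω)).re)
      ((‖(2 : ℝ) - (-2)‖₊ / 2) ^ 2) P := fun p _ => by
    refine hasSubgaussianMGF_of_mem_Icc_of_integral_eq_zero
      ((hg p).measurable.comp_aemeasurable (hlaw p).aemeasurable)
      (Eventually.of_forall fun ω => ?_) ?_
    · rw [Set.mem_Icc, ← abs_le]
      refine (Complex.abs_re_le_norm _).trans ?_
      rw [norm_mul]
      have := norm_fluct_le (norm_integral_character_le ν k) k p (ξ p ω)
      nlinarith [norm_nonneg u, norm_nonneg (fluct c k p (ξ p ω))]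
    · have h1 : ∫ ω, (u * fluct c k p (ξ p ω)).re ∂P = ∫ w, (u * fluct c k p w).re ∂ν := by
        rw [← (hlaw p).map_eq, integral_map (hlaw p).aemeasurable
          (hg p).aestronglyMeasurable]
      have h2 : Integrable (fun w => u * fluct c k p w) ν := by
        simp only [fluct_eq_mul]
        exact (((integrable_character ν k).sub (integrable_const c)).const_mul _).const_mul u
      rw [h1]
      refine (integral_re h2).trans ?_
      simp only [fluct_eq_mul]
      rw [integral_const_mul, integral_const_mul,
        integral_sub (integrable_character ν k) (integrable_const c)]
      simp [hc]
  refine (HasSubgaussianMGF.measure_sum_ge_le_of_iIndepFun hI hsub ht.le).trans ?_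
  have hcard : (0 : ℝ) < s.card := Nat.cast_pos.2 hne.card_pos
  have h4 : (((‖(2 : ℝ) - (-2)‖₊ / 2) ^ 2 : NNReal) : ℝ) = 4 := by
    push_cast
    norm_num
  rw [Finset.sum_const, nsmul_eq_mul]
  push_cast at h4 ⊢
  rw [h4]
  refine Real.exp_le_exp.2 ?_
  rw [neg_div, neg_div, neg_le_neg_iff]
  exact div_le_div_of_nonneg_left (by positivity) (by positivity) (by linarith)

lemma norm_lt_of_re_lt {z : ℂ} {t : ℝ}
    (h : ∀ u ∈ ({1, -1, Complex.I, -Complex.I} : Finset ℂ), (u * z).re < t) : ‖z‖ < 2 * t := by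
  simp only [Finset.mem_insert, Finset.mem_singleton, forall_eq_or_imp, forall_eq] at h
  obtain ⟨h1, h2, h3, h4⟩ := h
  simp only [one_mul, neg_mul, Complex.neg_re, Complex.mul_re, Complex.I_re, Complex.I_im,
    zero_mul, zero_sub, neg_neg] at h1 h2 h3 h4
  have := Complex.norm_le_abs_re_add_abs_im z
  have h5 : |z.re| < t := abs_lt.2 ⟨by linarith, h1⟩
  have h6 : |z.im| < t := abs_lt.2 ⟨by linarith, by linarith⟩
  linarith

/-- Union bound over at most `3 ^ d * n ^ (3 * d)` frequencies and four directions, then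
Borel–Cantelli. -/
lemma ae_eventually_grid [IsProbabilityMeasure P] (hd : 0 < d) (hX : UniformlyDiscrete X)
    (hdens : HasAsymptoticDensity X)
    (hindep : iIndepFun ξ P) (hlaw : ∀ p, HasLaw (ξ p) ν P) [IsProbabilityMeasure ν]
    {η : ℝ} (hη : 0 < η) :
    ∀ᵐ ω ∂P, ∀ᶠ n : ℕ in atTop, ∀ l ∈ grid d n,
      ‖∑ p ∈ (hX.finite_ballPoints n).toFinset,
        fluct (∫ x, character l x ∂ν) l p (ξ p ω)‖ ≤ η * (n : ℝ) ^ d := by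
  classical
  obtain ⟨C, hC, hcount⟩ := exists_count_le hX hdens
  set U : Finset ℂ := {1, -1, Complex.I, -Complex.I} with hU
  have hUn : ∀ u ∈ U, ‖u‖ ≤ 1 := by
    simp [hU]
  have hUc : (U.card : ℝ) ≤ 4 := by exact_mod_cast Finset.card_le_four
  -- Hoeffding's exponent with `t = η / 2 * n ^ d` and at most `2 * C * n ^ d` terms is `-c * n ^
  -- d`, and `n ≤ n ^ d`.
  set c := η ^ 2 / (64 * C) with hc
  have hc0 : 0 < c := by positivity
  let A : ℕ → E d → ℂ → Set Ω := fun n l u => {ω | η / 2 * (n : ℝ) ^ d ≤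
    ∑ p ∈ (hX.finite_ballPoints n).toFinset, (u * fluct (∫ x, character l x ∂ν) l p (ξ p ω)).re}
  have hA : ∀ n : ℕ, 0 < n → ∀ l, ∀ u ∈ U, P.real (A n l u) ≤ Real.exp (-c * n) := by
    intro n hn l u hu
    have hn1 : (1 : ℝ) ≤ n := Nat.one_le_cast.2 hn
    have hnd : (n : ℝ) ≤ (n : ℝ) ^ d := le_self_pow₀ hn1 hd.ne'
    have hcard : ((hX.finite_ballPoints n).toFinset.card : ℝ) ≤ 2 * C * (n : ℝ) ^ d := by
      rw [← Set.ncard_eq_toFinset_card _ (hX.finite_ballPoints n)]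
      refine (hcount n (by positivity)).trans ?_
      nlinarith
    refine (measure_sum_re_fluct_ge_le hindep hlaw _ hcard l (hUn u hu)
      (by positivity)).trans (Real.exp_le_exp.2 ?_)
    have : -(η / 2 * (n : ℝ) ^ d) ^ 2 / (8 * (2 * C * (n : ℝ) ^ d)) = -c * (n : ℝ) ^ d := by
      rw [hc]
      field_simp
      norm_num
    rw [this, neg_mul, neg_mul, neg_le_neg_iff]
    gcongr
  -- For `n = 0` every event `A 0 l u` is the whole space, as both sides of its inequality vanish
  -- when `d > 0`; this index is discarded.
  let B : ℕ → Set Ω := fun n => if 0 < n then ⋃ l ∈ grid d n, ⋃ u ∈ U, A n l u else ∅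
  have hB : ∀ n, P (B n)
      ≤ ENNReal.ofReal (3 ^ d * 4 * ((n : ℝ) ^ (3 * d) * Real.exp (-c * n))) := by
    intro n
    by_cases hn : 0 < n
    · simp only [B, if_pos hn]
      rw [← ofReal_measureReal (measure_ne_top P _)]
      refine ENNReal.ofReal_le_ofReal ?_
      calc P.real (⋃ l ∈ grid d n, ⋃ u ∈ U, A n l u)
          ≤ ∑ l ∈ grid d n, P.real (⋃ u ∈ U, A n l u) := measureReal_biUnion_finset_le _ _
        _ ≤ ∑ l ∈ grid d n, ∑ u ∈ U, P.real (A n l u) :=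
            Finset.sum_le_sum fun l _ => measureReal_biUnion_finset_le _ _
        _ ≤ ∑ l ∈ grid d n, ∑ u ∈ U, Real.exp (-c * n) :=
            Finset.sum_le_sum fun l _ => Finset.sum_le_sum fun u hu => hA n hn l u hu
        _ = (grid d n).card * (U.card * Real.exp (-c * n)) := by simp
        _ ≤ (3 ^ d * (n : ℝ) ^ (3 * d)) * (4 * Real.exp (-c * n)) := by
            gcongr
            exact card_grid_le d hn
        _ = _ := by ring
    · simp [B, hn]
  have hsum : ∑' n, P (B n) ≠ ⊤ := by
    refine ne_top_of_le_ne_top ?_ (ENNReal.tsum_le_tsum hB)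
    exact ((Real.summable_pow_mul_exp_neg_nat_mul (3 * d) hc0).mul_left _).tsum_ofReal_ne_top
  filter_upwards [ae_eventually_notMem hsum] with ω hω
  filter_upwards [hω, eventually_gt_atTop 0] with n hn hn0 l hl
  simp only [B, if_pos hn0, Set.mem_iUnion, not_exists] at hn
  have h := norm_lt_of_re_lt (t := η / 2 * (n : ℝ) ^ d) (z := ∑ p ∈
    (hX.finite_ballPoints n).toFinset, fluct (∫ x, character l x ∂ν) l p (ξ p ω)) fun u hu => by
      rw [Finset.mul_sum, Complex.re_sum]
      exact not_le.1 (hn l hl u hu)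
  linarith

lemma ae_forall_eventually_grid [IsProbabilityMeasure P] (hd : 0 < d) (hX : UniformlyDiscrete X)
    (hdens : HasAsymptoticDensity X)
    (hindep : iIndepFun ξ P) (hlaw : ∀ p, HasLaw (ξ p) ν P) [IsProbabilityMeasure ν] :
    ∀ᵐ ω ∂P, ∀ η : ℝ, 0 < η → ∀ᶠ n : ℕ in atTop, ∀ l ∈ grid d n,
      ‖∑ p ∈ (hX.finite_ballPoints n).toFinset,
        fluct (∫ x, character l x ∂ν) l p (ξ p ω)‖ ≤ η * (n : ℝ) ^ d := by
  have h : ∀ᵐ ω ∂P, ∀ m : ℕ, ∀ᶠ n : ℕ in atTop, ∀ l ∈ grid d n,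
      ‖∑ p ∈ (hX.finite_ballPoints n).toFinset,
        fluct (∫ x, character l x ∂ν) l p (ξ p ω)‖ ≤ 1 / ((m : ℝ) + 1) * (n : ℝ) ^ d :=
    ae_all_iff.2 fun m => ae_eventually_grid hd hX hdens hindep hlaw Nat.one_div_pos_of_nat
  filter_upwards [h] with ω hω η hη
  obtain ⟨m, hm⟩ := exists_nat_one_div_lt hη
  filter_upwards [hω m] with n hn l hl
  exact (hn l hl).trans (by gcongr)

/-! ### Consequences, and the zero-dimensional case -/

lemma tendsto_perturbedMeanExp_of_sub {v : X → E d} {c a : ℂ} {k : E d}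
    (h : Tendsto (fun R : ℝ => perturbedMeanExp X v R k - c * meanExp X R k) atTop (𝓝 0))
    (ha : HasWeakFourier X k a) :
    Tendsto (fun R : ℝ => perturbedMeanExp X v R k) atTop (𝓝 (c * a)) := by
  have ha' : Tendsto (fun R : ℝ => meanExp X R k) atTop (𝓝 a) := ha
  simpa using h.add (ha'.const_mul c)

lemma perturbedMeanExp_of_subsingleton [Subsingleton (E d)] (v : X → E d) (R : ℝ) (k : E d) :
    perturbedMeanExp X v R k = meanExp X R k := by
  rw [perturbedMeanExp, meanExp, expSum_eq_finsum]
  have h : ∀ p : X, (p : E d) + v p = p := fun p => Subsingleton.elim _ _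
  simp only [h]
  rfl

lemma integral_character_of_subsingleton [Subsingleton (E d)] [IsProbabilityMeasure ν] (k : E d) :
    ∫ x, character k x ∂ν = 1 := by
  have h : ∀ x : E d, character k x = 1 := fun x => by
    rw [Subsingleton.elim x 0]
    simp [character]
  simp [h]

end PerturbedSet

theorem theoremA {d : ℕ} (X : Set (E d)) (hX : UniformlyDiscrete X)
    (hdens : HasAsymptoticDensity X) (hdiff : HasSingularDiffraction X)
    {Ω : Type*} [MeasurableSpace Ω] (P : Measure Ω) [IsProbabilityMeasure P]
    (ξ : X → Ω → E d) (hindep : iIndepFun ξ P)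
    (ν : Measure (E d)) (hlaw : ∀ p, HasLaw (ξ p) ν P)
    (ε : ℝ) (hε : 0 < ε) (hmom : Integrable (fun x : E d => ‖x‖ ^ ((d : ℝ) + ε)) ν) :
    ∀ᵐ ω ∂P,
      -- the perturbed configuration is locally finite, so that all the sums `M_R` are finite sums
      (∀ R : ℝ, {p : X | (p : E d) + ξ p ω ∈ Metric.ball (0 : E d) R}.Finite) ∧
      -- `M_R(k)` is asymptotic to `𝔼[e^{-2πi⟨ξ,k⟩}]` times the mean defining the weak Fourier
      -- transform of `X` at `k`, for every `k`, whether or not the latter converges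
      (∀ k : E d, Tendsto
        (fun R : ℝ => perturbedMeanExp X (fun p => ξ p ω) R k
          - (∫ x, character k x ∂ν) * meanExp X R k) atTop (𝓝 0)) ∧
      -- in particular, the limit formula wherever the weak Fourier transform exists
      (∀ (k : E d) (a : ℂ), HasWeakFourier X k a → Tendsto
        (fun R : ℝ => perturbedMeanExp X (fun p => ξ p ω) R k) atTop
          (𝓝 ((∫ x, character k x ∂ν) * a))) ∧
      -- the same asymptotics for the measures with these densities, in the vague topology
      (∀ f : E d → ℂ, Continuous f → HasCompactSupport f → Tendsto
        (fun R : ℝ => ∫ k, f k * (perturbedMeanExp X (fun p => ξ p ω) R k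
          - (∫ x, character k x ∂ν) * meanExp X R k)) atTop (𝓝 0)) := by
  -- Positive density forces a point of `X`; its perturbation then exhibits `ν` as a pushforward of
  -- `P`, hence a probability measure.
  have hne : Nonempty X := by
    by_contra hX0
    rw [not_nonempty_iff] at hX0
    obtain ⟨D, hD, ho⟩ := hdens
    have h1 : Tendsto (fun _ : ℝ => -(D * unitVol d)) atTop (𝓝 0) := by
      refine ho.tendsto_div_nhds_zero.congr' ?_
      filter_upwards [eventually_gt_atTop 0] with R hR
      rw [volBall_eq d hR, Set.isEmpty_coe_sort.1 hX0]
      simp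
      field_simp
    have h2 := tendsto_nhds_unique h1 tendsto_const_nhds
    have := mul_pos hD (unitVol_pos d)
    linarith
  have : IsProbabilityMeasure ν := by
    obtain ⟨p⟩ := hne
    rw [← (hlaw p).map_eq]
    exact Measure.isProbabilityMeasure_map (hlaw p).aemeasurable
  -- In dimension 0 the normalization `R ^ d` does not grow, but nothing can move: both means agree
  -- and the characteristic function is 1.
  rcases Nat.eq_zero_or_pos d with rfl | hd
  · have hfin : Finite X := inferInstance
    refine Eventually.of_forall fun ω => ⟨fun R => Set.toFinite _, fun k => ?_, fun k a ha => ?_,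
      fun f _ _ => ?_⟩
    · simp [perturbedMeanExp_of_subsingleton, integral_character_of_subsingleton]
    · simpa [perturbedMeanExp_of_subsingleton, integral_character_of_subsingleton,
        HasWeakFourier] using ha
    · simp [perturbedMeanExp_of_subsingleton, integral_character_of_subsingleton]
  have hd1 : (1 : ℝ) ≤ d := Nat.one_le_cast.2 hd
  have hmd := integrable_norm_pow hmom (m := d) (by linarith)
  have hm1 : Integrable (fun x : E d => ‖x‖) ν := by
    simpa using integrable_norm_pow hmom (m := 1) (by push_cast; linarith)
  filter_upwards [ae_forall_finite_farMoved hX hdens hlaw hmd,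
    ae_forall_eventually_grid hd hX hdens hindep hlaw] with ω hfar hgrid
  have hφ := norm_integral_character_le ν
  have hlim : ∀ k : E d, Tendsto
      (fun R : ℝ => perturbedMeanExp X (fun p => ξ p ω) R k
        - (∫ x, character k x ∂ν) * meanExp X R k) atTop (𝓝 0) := fun k =>
    tendsto_sub_meanExp hX hd hdens hfar (hφ k)
      (tendsto_sum_fluct_of_grid hX hdens (hfar 1 one_pos) hφ
        (L := 2 * Real.pi * ∫ x, ‖x‖ ∂ν)
        (fun k l => (norm_integral_character_sub_le hm1 k l).trans_eq (by ring)) hgrid k)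
  exact ⟨finite_perturbedPoints hX hfar, hlim,
    fun k a ha => tendsto_perturbedMeanExp_of_sub (hlim k) ha,
    fun f hf hfs => tendsto_integral_mul_sub_meanExp hX hd hdens hfar hφ
      (continuous_integral_character ν) hlim hf hfs⟩
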